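/- Let $\theta$ be a symplectic (bilinear, skew-symmetric, nondegenerate) form on $\mathbb R^d$, and let $E$ be a complete nuclear barrelled locally convex space (over $\mathbb C$) which is a vector subspace of the Schwartz space $S(\mathbb R^d)$ with continuous inclusion. Let $E'$ be the space of continuous linear functionals on $E$, and let $E\mathbin{\widetilde\otimes}E$ be the completed projective tensor product; its elements are regarded as functions $h(s,t)$ on $\mathbb R^{d}\times\mathbb R^d$, $f\otimes g$ being the function $f(s)g(t)$. For a locally convex space $F$ of functions, a continuous function $\mu$ is a pointwise multiplier of $F$ if $\mu h\in F$ for all $h\in F$ and the map $h\mapsto\mu h$ of $F$ into itself is continuous; $M(F)$ is the space of all such $\mu$, with the topology induced by that of the space $\mathcal L(F)$ of continuous linear operators on $F$ (uniform convergence on bounded sets). Assume that (1) the function $e^{-\frac i2\theta(s,t)}$ belongs to $M(E\mathbin{\widetilde\otimes}E)$; (2) the transformation $h(s,t)\mapsto h(s,s-t)$ is a continuous automorphism of $E\mathbin{\widetilde\otimes}E$; (3) $E$ is dense in $M(E)$, i.e. the elements of $M(E)$ which are functions in $E$ form a dense subset of $M(E)$. Then every $g\in E$ is a pointwise multiplier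 of $E$, the natural injection $E\to M(E)$ is continuous, its transpose $M'(E)\to E'$, $w\mapsto w|_E$, defined on the space $M'(E)$ of continuous linear functionals on $M(E)$, is injective, and with this identification $$M'(E)\subset\mathcal C_\theta(E)=\mathcal C_{\theta,L}(E)\cap\mathcal C_{\theta,R}(E).$$ Here $\mathcal C_{\theta,L}(E)$ (respectively $\mathcal C_{\theta,R}(E)$) is the set of all $v\in E'$ such that for each $g\in E$ the function $v\circledast g$ (respectively $g\circledast v$) is well defined and belongs to $E$, and the map $g\mapsto v\circledast g$ (respectively $g\mapsto g\circledast v$) of $E$ into itself is continuous, where $$(v\circledast g)(s)=\big\langle v,\,e^{\frac i2\theta(s,\cdot)}g(s-\cdot)\big\rangle,\qquad (g\circledast v)(s)=\big\langle v,\,e^{-\frac i2\theta(s,\cdot)}g(s-\cdot)\big\rangle ,$$ and "well defined" means that the functions $t\mapsto e^{\pm\frac i2\theta(s,t)}g(s-t)$ on which $v$ is evaluated (with the corresponding sign) belong to $E$ for all $s\in\mathbb R^d$. -/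

import Mathlib

open scoped SchwartzMap TensorProduct
open UniformSpace (Completion)

/-! ### Nuclear spaces -/

section Nuclear

variable {E : Type*} [AddCommGroup E] [Module ℂ E]

/-- The vector space `E` equipped with the single seminorm `p`. -/
def SeminormSpace (_p : Seminorm ℂ E) : Type _ := E

noncomputable instance (p : Seminorm ℂ E) : SeminormedAddCommGroup (SeminormSpace p) :=
  p.toAddGroupSeminorm.toSeminormedAddCommGroup

noncomputable instance (p : Seminorm ℂ E) : Module ℂ (SeminormSpace p) :=
  inferInstanceAs (Module ℂ E)

noncomputable instance (p : Seminorm ℂ E) : NormedSpace ℂ (SeminormSpace p) where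
  norm_smul_le c x := (map_smul_eq_mul p c (x : E)).le

/-- The local Banach space of `E` at the seminorm `p`: the (Hausdorff) completion of `(E, p)`. -/
abbrev LocalBanach (p : Seminorm ℂ E) : Type _ := Completion (SeminormSpace p)

/-- The canonical map of `E` into its local Banach space at `p`. -/
noncomputable def toLocalBanach (p : Seminorm ℂ E) (x : E) : LocalBanach p :=
  ((show SeminormSpace p from x) : Completion (SeminormSpace p))

variable (E) in
/-- A locally convex space `E` is nuclear if, for every continuous seminorm `p`, the canonical map
of `E` into the local Banach space at `p` is a nuclear map, i.e. of the form
`x ↦ ∑ₙ cₙ φₙ(x) yₙ` with `(cₙ)` absolutely summable, `(φₙ)` an equicontinuous sequence of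
continuous linear functionals and `(yₙ)` a bounded sequence. -/
def IsNuclearSpace [TopologicalSpace E] : Prop :=
  ∀ p : Seminorm ℂ E, Continuous p →
    ∃ (c : ℕ → ℂ) (φ : ℕ → E →L[ℂ] ℂ) (y : ℕ → LocalBanach p),
      Summable (fun n => ‖c n‖) ∧
      (∃ q : Seminorm ℂ E, Continuous q ∧ ∀ n x, ‖φ n x‖ ≤ q x) ∧
      (∃ C : ℝ, ∀ n, ‖y n‖ ≤ C) ∧
      ∀ x : E, HasSum (fun n => c n • φ n x • y n) (toLocalBanach p x)

end Nuclear

/-! ### The completed projective tensor product -/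

section Projective

variable (E F : Type*) [AddCommGroup E] [Module ℂ E] [TopologicalSpace E]
  [AddCommGroup F] [Module ℂ F] [TopologicalSpace F]

/-- The algebraic tensor product, to be equipped with the projective topology. -/
def ProjTensor : Type _ := E ⊗[ℂ] F

noncomputable instance : AddCommGroup (ProjTensor E F) := inferInstanceAs (AddCommGroup (E ⊗[ℂ] F))

noncomputable instance : Module ℂ (ProjTensor E F) := inferInstanceAs (Module ℂ (E ⊗[ℂ] F))

/-- The seminorms `r` on `E ⊗ F` for which the canonical bilinear map `E × F → (E ⊗ F, r)` is
continuous. -/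
abbrev ProjSeminorm : Type _ :=
  {r : Seminorm ℂ (ProjTensor E F) // Continuous fun z : E × F => r (z.1 ⊗ₜ[ℂ] z.2 : E ⊗[ℂ] F)}

instance : Nonempty (ProjSeminorm E F) := ⟨⟨0, continuous_const⟩⟩

/-- The defining family of seminorms of the projective topology. -/
def projSeminormFamily : SeminormFamily ℂ (ProjTensor E F) (ProjSeminorm E F) := fun r => r.1

/-- The projective topology: the finest locally convex topology for which the canonical bilinear
map `E × F → E ⊗ F` is continuous. -/
noncomputable instance : TopologicalSpace (ProjTensor E F) :=
  (projSeminormFamily E F).moduleFilterBasis.topology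

theorem withSeminorms_projTensor : WithSeminorms (projSeminormFamily E F) := ⟨rfl⟩

instance : IsTopologicalAddGroup (ProjTensor E F) :=
  (withSeminorms_projTensor E F).topologicalAddGroup

instance : ContinuousSMul ℂ (ProjTensor E F) := (withSeminorms_projTensor E F).continuousSMul

noncomputable instance : UniformSpace (ProjTensor E F) :=
  IsTopologicalAddGroup.rightUniformSpace (ProjTensor E F)

instance : IsUniformAddGroup (ProjTensor E F) := isUniformAddGroup_of_addCommGroup

instance : UniformContinuousConstSMul ℂ (ProjTensor E F) :=
  uniformContinuousConstSMul_of_continuousConstSMul ℂ (ProjTensor E F)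

/-- The completed projective tensor product of `E` and `F`. -/
abbrev CompletedTensor : Type _ := Completion (ProjTensor E F)

variable {E F}

/-- The functional `u ⊗ v` on `E ⊗ F`, with `(u ⊗ v)(f ⊗ g) = u(f) v(g)`. -/
noncomputable def tensorFunctional (u : E →L[ℂ] ℂ) (v : F →L[ℂ] ℂ) : ProjTensor E F →L[ℂ] ℂ where
  toLinearMap := (LinearMap.mul' ℂ ℂ ∘ₗ
    TensorProduct.map (u : E →ₗ[ℂ] ℂ) (v : F →ₗ[ℂ] ℂ) : E ⊗[ℂ] F →ₗ[ℂ] ℂ)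
  cont := by
    set L : ProjTensor E F →ₗ[ℂ] ℂ := (LinearMap.mul' ℂ ℂ ∘ₗ
      TensorProduct.map (u : E →ₗ[ℂ] ℂ) (v : F →ₗ[ℂ] ℂ) : E ⊗[ℂ] F →ₗ[ℂ] ℂ) with hL
    have hr : Continuous fun z : E × F =>
        ((normSeminorm ℂ ℂ).comp L) (z.1 ⊗ₜ[ℂ] z.2 : E ⊗[ℂ] F) := by
      have h : (fun z : E × F => ((normSeminorm ℂ ℂ).comp L) (z.1 ⊗ₜ[ℂ] z.2 : E ⊗[ℂ] F))
          = fun z : E × F => ‖u z.1 * v z.2‖ := by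
        funext z
        rfl
      rw [h]
      fun_prop
    exact (withSeminorms_projTensor E F).continuous_normedSpace_rng ℂ L
      ⟨{⟨_, hr⟩}, 1, by intro x; simp [projSeminormFamily]⟩

/-- The extension of `u ⊗ v` by continuity to the completed projective tensor product. -/
noncomputable def completedTensorFunctional (u : E →L[ℂ] ℂ) (v : F →L[ℂ] ℂ) :
    CompletedTensor E F →L[ℂ] ℂ :=
  (tensorFunctional u v).fromCompletion

end Projective

/-! ### Pointwise multipliers -/

/-- Let `F` be a space of functions on `X`, where `ev h` is the function given by `h : F`. A
continuous function `μ` on `X` is a pointwise multiplier of `F` if `μ h` belongs to `F` for every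
`h : F` and `h ↦ μ h` is a continuous linear map `F → F`. -/
def IsPointwiseMultiplier {F X : Type*} [AddCommGroup F] [Module ℂ F] [TopologicalSpace F]
    [TopologicalSpace X] (ev : F → X → ℂ) (μ : X → ℂ) : Prop :=
  Continuous μ ∧ ∃ T : F →L[ℂ] F, ∀ h x, ev (T h) x = μ x * ev h x

section FunctionSpace

/- A locally convex space `E` that is a subspace of the Schwartz space, with a continuous inclusion,
is given by an injective continuous linear map `j : E → 𝓢(ℝᵈ)`. -/
variable {d : ℕ} {E : Type*} [AddCommGroup E] [Module ℂ E] [TopologicalSpace E]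
  (j : E →L[ℂ] 𝓢(EuclideanSpace ℝ (Fin d), ℂ))

/-- The functional `δₛ : g ↦ g(s)` on `E`. -/
noncomputable def deltaFunctional (s : EuclideanSpace ℝ (Fin d)) : E →L[ℂ] ℂ :=
  (BoundedContinuousFunction.evalCLM ℂ s) ∘L
    (SchwartzMap.toBoundedContinuousFunctionCLM ℂ (EuclideanSpace ℝ (Fin d)) ℂ) ∘L j

theorem deltaFunctional_apply (s : EuclideanSpace ℝ (Fin d)) (g : E) :
    deltaFunctional j s g = j g s := rfl

/-- The function on `ℝᵈ × ℝᵈ` given by an element of the completed projective tensor product of `E`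
with itself: it depends continuously on the element, and `f ⊗ g` gives `(s, t) ↦ f(s) g(t)`. -/
noncomputable def tensorEval (h : CompletedTensor E E)
    (z : EuclideanSpace ℝ (Fin d) × EuclideanSpace ℝ (Fin d)) : ℂ :=
  completedTensorFunctional (deltaFunctional j z.1) (deltaFunctional j z.2) h

theorem tensorEval_tmul (f g : E) (s t : EuclideanSpace ℝ (Fin d)) :
    tensorEval j ((show ProjTensor E E from f ⊗ₜ[ℂ] g) : Completion (ProjTensor E E)) (s, t)
      = j f s * j g t :=
  (tensorFunctional (deltaFunctional j s) (deltaFunctional j t)).fromCompletion_apply_coe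
    (show ProjTensor E E from f ⊗ₜ[ℂ] g)

variable [IsTopologicalAddGroup E] [ContinuousConstSMul ℂ E]

/-- The set of pointwise multipliers of `E`, as a vector space of functions on `ℝᵈ`. -/
def multiplierSubmodule : Submodule ℂ (EuclideanSpace ℝ (Fin d) → ℂ) where
  carrier := {μ | IsPointwiseMultiplier (fun g => j g) μ}
  zero_mem' := ⟨continuous_const, 0, by simp⟩
  add_mem' := by
    rintro μ ν ⟨hμ, T, hT⟩ ⟨hν, S, hS⟩
    exact ⟨hμ.add hν, T + S, by simp [hT, hS, add_mul]⟩
  smul_mem' := by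
    rintro c μ ⟨hμ, T, hT⟩
    exact ⟨hμ.const_smul c, c • T, by simp [hT, mul_assoc]⟩

/-- The space `M(E)` of pointwise multipliers of `E`. -/
def PointwiseMultiplier : Type _ := multiplierSubmodule j

noncomputable instance : AddCommGroup (PointwiseMultiplier j) :=
  inferInstanceAs (AddCommGroup (multiplierSubmodule j))

noncomputable instance : Module ℂ (PointwiseMultiplier j) :=
  inferInstanceAs (Module ℂ (multiplierSubmodule j))

instance : CoeFun (PointwiseMultiplier j) fun _ => EuclideanSpace ℝ (Fin d) → ℂ := ⟨fun m => m.1⟩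

/-- The operator of multiplication by `m` on `E` (the only one with `j (T g) = m · j g` if `j` is
injective). -/
noncomputable def PointwiseMultiplier.toOperator (m : PointwiseMultiplier j) : E →L[ℂ] E :=
  m.2.2.choose

/-- The topology of `M(E)` is induced by that of the algebra of continuous linear operators on `E`,
i.e. by the topology of uniform convergence on bounded sets. -/
noncomputable instance : TopologicalSpace (PointwiseMultiplier j) :=
  TopologicalSpace.induced (PointwiseMultiplier.toOperator j) inferInstance

/-! ### Twisted convolution -/

variable (θ : LinearMap.BilinForm ℝ (EuclideanSpace ℝ (Fin d)))

/-- `v ⊛ g` is defined and equal to `F`: for every `s`, the function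
`t ↦ exp((i/2) θ(s, t)) g(s - t)` belongs to `E`, and the value of `v` on it is `F(s)`. -/
def HasTwistedConvLeft (v : E →L[ℂ] ℂ) (g : E) (F : EuclideanSpace ℝ (Fin d) → ℂ) : Prop :=
  ∀ s, ∃ k : E, (∀ t, j k t = Complex.exp (Complex.I / 2 * (θ s t : ℂ)) * j g (s - t)) ∧ F s = v k

/-- `g ⊛ v` is defined and equal to `F`: for every `s`, the function
`t ↦ exp(-(i/2) θ(s, t)) g(s - t)` belongs to `E`, and the value of `v` on it is `F(s)`. -/
def HasTwistedConvRight (g : E) (v : E →L[ℂ] ℂ) (F : EuclideanSpace ℝ (Fin d) → ℂ) : Prop :=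
  ∀ s, ∃ k : E,
    (∀ t, j k t = Complex.exp (-(Complex.I / 2) * (θ s t : ℂ)) * j g (s - t)) ∧ F s = v k

/-- The functionals `v` such that `v ⊛ g` is in `E` for all `g` in `E`, with `g ↦ v ⊛ g`
continuous. -/
def leftTwistedMultipliers : Set (E →L[ℂ] ℂ) :=
  {v | ∃ T : E →L[ℂ] E, ∀ g, HasTwistedConvLeft j θ v g (j (T g))}

/-- The functionals `v` such that `g ⊛ v` is in `E` for all `g` in `E`, with `g ↦ g ⊛ v`
continuous. -/
def rightTwistedMultipliers : Set (E →L[ℂ] ℂ) :=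
  {v | ∃ T : E →L[ℂ] E, ∀ g, HasTwistedConvRight j θ g v (j (T g))}

/-- The two-sided twisted convolution multipliers of `E`. -/
def twistedMultipliers : Set (E →L[ℂ] ℂ) :=
  leftTwistedMultipliers j θ ∩ rightTwistedMultipliers j θ

end FunctionSpace

/-! Let χ be one of the two exponential factors. Applying `w` to the functions t ↦ χ(t,s) g(s−t)
gives a function of s, and the point is to show that it lies in E and depends continuously on g.

The idea is to replace evaluation at s by an arbitrary functional u in E'. With K_s(t) = χ(s,t)
g(t−s), put m_u(s) = u(K_s). This is a multiplier of E, because m_u f is the slice id ⊗ u of the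
element χ(s,t) f(s) g(t−s) of E ⊗̃ E; for u = δ_s it is the function t ↦ χ(t,s) g(s−t). Hence u ↦
w(m_u) is a linear functional on E'. It is bounded on equicontinuous sets: `w` is controlled by a
seminorm on a bounded set (`exists_bound_of_multiplier_functional`), and the slices are
equicontinuous in u (`rightSlice_equicontinuous`). On a complete nuclear space such a functional is
evaluation at an element T g of E (`IsNuclearSpace.exists_eq_eval`), and u = δ_s gives (T g)(s) =
w(m_{δ_s}). The bound is uniform for g near 0, so T is continuous (`exists_twisted_operator`).

The substitution h(s,t) ↦ h(s,s−t) supplies the rest: restriction to t = 0 gives the product of E,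
hence E → M(E); restriction to fixed s gives shifts and reflection; conjugation reverses the sign in
the exponential. Injectivity of the transpose is density of E in M(E). -/

open Filter Topology Bornology

/-! ### Seminorms, functionals and finite-rank approximation -/

section LocallyConvex

variable {E : Type*} [AddCommGroup E] [Module ℂ E]

/-- A linear functional on `E` dominated by a continuous seminorm is continuous. -/
noncomputable def functionalOfLeSeminorm [TopologicalSpace E] [IsTopologicalAddGroup E]
    (u : E →ₗ[ℂ] ℂ) (p : Seminorm ℂ E) (hp : Continuous p) (hu : ∀ x, ‖u x‖ ≤ p x) :
    E →L[ℂ] ℂ where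
  toLinearMap := u
  cont := by
    have h : Continuous ((normSeminorm ℂ ℂ).comp u) := Seminorm.continuous_of_le hp hu
    exact (norm_withSeminorms ℂ ℂ).continuous_of_continuous_comp u fun _ => h

/-- Hahn–Banach in the seminormed space (E, p): a functional of norm at most 1 that norms `x` there
is dominated by `p`, hence continuous on E. -/
theorem exists_functional_eq_seminorm [TopologicalSpace E] [IsTopologicalAddGroup E]
    (p : Seminorm ℂ E) (hp : Continuous p) (x : E) :
    ∃ u : E →L[ℂ] ℂ, (∀ y, ‖u y‖ ≤ p y) ∧ ‖u x‖ = p x := by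
  obtain ⟨g, hg, hgx⟩ := exists_dual_vector'' ℂ (show SeminormSpace p from x)
  have hle : ∀ y : E, ‖g (show SeminormSpace p from y)‖ ≤ p y := fun y =>
    (g.le_of_opNorm_le hg (show SeminormSpace p from y)).trans_eq (one_mul _)
  refine ⟨functionalOfLeSeminorm
    ({ toFun := fun y => g (show SeminormSpace p from y)
       map_add' := fun y z => g.map_add _ _
       map_smul' := fun c y => g.map_smul _ _ } : E →ₗ[ℂ] ℂ) p hp hle, hle, ?_⟩
  change ‖g (show SeminormSpace p from x)‖ = p x
  exact (congrArg norm hgx).trans ((RCLike.norm_ofReal _).trans (abs_norm _))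

/-- To bound a seminorm it suffices to bound the functionals that it dominates. -/
theorem seminorm_le_of_forall_functional [TopologicalSpace E] [IsTopologicalAddGroup E]
    {p : Seminorm ℂ E} (hp : Continuous p) {x : E} {C : ℝ}
    (h : ∀ u : E →L[ℂ] ℂ, (∀ y, ‖u y‖ ≤ p y) → ‖u x‖ ≤ C) : p x ≤ C := by
  obtain ⟨u, hu, hux⟩ := exists_functional_eq_seminorm p hp x
  exact hux ▸ h u hu

theorem exists_seminorm_of_mem_nhds_zero [TopologicalSpace E] [PolynormableSpace ℂ E]
    {U : Set E} (hU : U ∈ 𝓝 0) :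
    ∃ p : Seminorm ℂ E, Continuous p ∧ ∀ x, p x ≤ 1 → x ∈ U := by
  have hE := PolynormableSpace.withSeminorms ℂ E
  have := hE.topologicalAddGroup
  obtain ⟨s, r, hr, hsub⟩ := (hE.mem_nhds_iff 0 U).1 hU
  set q : Seminorm ℂ E := s.sup fun p => p.1 with hq
  have hqc : Continuous q := Seminorm.continuous_finsetSup fun i _ => i.2
  -- The factor 2 turns the non-strict bound into q x ≤ r / 2 < r.
  let c : NNReal := ⟨2 / r, by positivity⟩
  refine ⟨c • q, hqc.const_smul c, fun x hx => hsub ?_⟩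
  rw [Seminorm.mem_ball_zero]
  have hx' : 2 / r * q x ≤ 1 := hx
  rw [div_mul_eq_mul_div, div_le_one hr] at hx'
  have := apply_nonneg q x
  change q x < r
  linarith

/-- On a nuclear space the identity is approximated by operators of finite rank, in the seminorm
`p` and relative to a seminorm `q`. -/
theorem IsNuclearSpace.exists_finiteRank_approx [TopologicalSpace E] (hE : IsNuclearSpace E)
    (p : Seminorm ℂ E) (hp : Continuous p) :
    ∃ q : Seminorm ℂ E, Continuous q ∧ ∀ ε > 0, ∃ (N : ℕ) (φ : ℕ → E →L[ℂ] ℂ) (y : ℕ → E),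
      ∀ x, p (x - ∑ n ∈ Finset.range N, φ n x • y n) ≤ ε * q x := by
  obtain ⟨c, φ, y, hc, ⟨q, hq, hφ⟩, ⟨C, hC⟩, hsum⟩ := hE p hp
  refine ⟨q, hq, fun ε hε => ?_⟩
  have hC0 : 0 ≤ C := (norm_nonneg _).trans (hC 0)
  set S : ℝ := ∑' n, ‖c n‖ with hS
  have hS0 : 0 ≤ S := tsum_nonneg fun _ => norm_nonneg _
  -- Half of ε pays for the tail of the nuclear series, the other half for replacing each `y n` of
  -- the local Banach space by a vector of E within δ. The added 1's keep the denominators positive.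
  obtain ⟨N, hN⟩ : ∃ N, ∑' n, ‖c (n + N)‖ ≤ ε / (2 * (C + 1)) :=
    ((tendsto_sum_nat_add fun n => ‖c n‖).eventually (ge_mem_nhds (by positivity))).exists
  set δ : ℝ := ε / (2 * (S + 1)) with hδ
  have hδ0 : 0 < δ := by positivity
  have happ : ∀ n, ∃ z : E, ‖y n - toLocalBanach p z‖ ≤ δ := fun n => by
    obtain ⟨z, hz⟩ := (Completion.denseRange_coe (α := SeminormSpace p)).exists_dist_lt (y n) hδ0
    exact ⟨z, by rw [← dist_eq_norm]; exact hz.le⟩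
  choose z hz using happ
  refine ⟨N, fun n => c n • φ n, z, fun x => ?_⟩
  have hadd : ∀ a b : E, toLocalBanach p (a - b) = toLocalBanach p a - toLocalBanach p b :=
    fun a b => Completion.coe_sub (α := SeminormSpace p) a b
  let ι : E →ₗ[ℂ] LocalBanach p :=
    { toFun := toLocalBanach p
      map_add' := fun a b => Completion.coe_add (α := SeminormSpace p) a b
      map_smul' := fun r a => Completion.coe_smul (X := SeminormSpace p) r a }
  have hι : ∀ a, ‖ι a‖ = p a := fun a => Completion.norm_coe (E := SeminormSpace p) a
  have hιx : HasSum (fun n => c n • φ n x • y n) (ι x) := hsum x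
  rw [← hι]
  have hsplit : ι (x - ∑ n ∈ Finset.range N, (c n • φ n) x • z n)
      = (∑' n, c (n + N) • φ (n + N) x • y (n + N))
        + ∑ n ∈ Finset.range N, (c n * φ n x) • (y n - ι (z n)) := by
    rw [map_sub, map_sum, ← hιx.tsum_eq, ← hιx.summable.sum_add_tsum_nat_add N]
    simp only [map_smul, smul_sub, Finset.sum_sub_distrib, smul_smul, smul_eq_mul,
      smul_apply]
    abel
  rw [hsplit]
  have hqx := apply_nonneg q x
  have h1 : ‖∑' n, c (n + N) • φ (n + N) x • y (n + N)‖ ≤ ε / 2 * q x := by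
    have hs : Summable fun n => ‖c (n + N)‖ := (summable_nat_add_iff N).2 hc
    have hb : ‖∑' n, c (n + N) • φ (n + N) x • y (n + N)‖
        ≤ (∑' n, ‖c (n + N)‖) * (q x * C) := by
      refine tsum_of_norm_bounded (hs.hasSum.mul_right _) fun n => ?_
      rw [norm_smul, norm_smul]
      gcongr
      · exact hφ _ _
      · exact hC _
    refine hb.trans ((mul_le_mul_of_nonneg_right hN (by positivity)).trans ?_)
    have : C / (C + 1) ≤ 1 := (div_le_one (by positivity)).2 (by linarith)
    calc ε / (2 * (C + 1)) * (q x * C) = ε / 2 * q x * (C / (C + 1)) := by field_simp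
      _ ≤ ε / 2 * q x * 1 := by gcongr
      _ = _ := mul_one _
  have h2 : ‖∑ n ∈ Finset.range N, (c n * φ n x) • (y n - ι (z n))‖ ≤ ε / 2 * q x := by
    have hb : ‖∑ n ∈ Finset.range N, (c n * φ n x) • (y n - ι (z n))‖
        ≤ ∑ n ∈ Finset.range N, ‖c n‖ * (q x * δ) := by
      refine norm_sum_le_of_le _ fun n _ => ?_
      rw [norm_smul, norm_mul, mul_assoc]
      gcongr
      · exact hφ _ _
      · exact hz n
    rw [← Finset.sum_mul] at hb
    have hcS : ∑ n ∈ Finset.range N, ‖c n‖ ≤ S := hc.sum_le_tsum _ fun _ _ => norm_nonneg _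
    refine hb.trans ((mul_le_mul_of_nonneg_right hcS (by positivity)).trans ?_)
    have : S / (S + 1) ≤ 1 := (div_le_one (by positivity)).2 (by linarith)
    calc S * (q x * δ) = ε / 2 * q x * (S / (S + 1)) := by rw [hδ]; field_simp
      _ ≤ ε / 2 * q x * 1 := by gcongr
      _ = _ := mul_one _
  calc _ ≤ ε / 2 * q x + ε / 2 * q x := norm_add_le_of_le h1 h2
    _ = ε * q x := by ring

end LocallyConvex

/-! ### Functionals on the dual of a complete nuclear space -/

section Reflexivity

variable {E : Type*} [AddCommGroup E] [Module ℂ E] [UniformSpace E] [IsUniformAddGroup E]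
  [PolynormableSpace ℂ E] [CompleteSpace E]

/-- On the dual of a complete nuclear space, every linear functional that is bounded on
equicontinuous sets is the evaluation at an element of the space. -/
theorem IsNuclearSpace.exists_eq_eval (hE : IsNuclearSpace E) (Φ : (E →L[ℂ] ℂ) →ₗ[ℂ] ℂ)
    (hΦ : ∀ q : Seminorm ℂ E, Continuous q →
      ∃ C : ℝ, ∀ u : E →L[ℂ] ℂ, (∀ x, ‖u x‖ ≤ q x) → ‖Φ u‖ ≤ C) :
    ∃ k : E, ∀ u : E →L[ℂ] ℂ, Φ u = u k := by
  let Q := {q : Seminorm ℂ E // Continuous q}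
  -- The points that represent Φ up to error 1 on the polar of q. These sets shrink as q grows; they
  -- will generate a Cauchy filter whose limit represents Φ exactly.
  let A : Q → Set E := fun q => {k | ∀ u : E →L[ℂ] ℂ, (∀ x, ‖u x‖ ≤ q.1 x) → ‖Φ u - u k‖ ≤ 1}
  have hne : ∀ q, (A q).Nonempty := by
    rintro ⟨p, hp⟩
    obtain ⟨q, hq, happ⟩ := hE.exists_finiteRank_approx p hp
    obtain ⟨C, hC⟩ := hΦ q hq
    obtain ⟨N, φ, y, hy⟩ := happ (1 / (|C| + 1)) (by positivity)
    -- Apply Φ to u composed with the finite-rank operator. The error is Φ(u'), where u' is u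
    -- composed with the remainder; it is dominated by q / (|C| + 1), so the error is less than 1.
    refine ⟨∑ n ∈ Finset.range N, Φ (φ n) • y n, fun u hu => ?_⟩
    set u' : E →L[ℂ] ℂ := u - ∑ n ∈ Finset.range N, u (y n) • φ n with hu'
    have h1 : Φ u' = Φ u - u (∑ n ∈ Finset.range N, Φ (φ n) • y n) := by
      simp [hu', mul_comm]
    have h2 : ∀ x, ‖u' x‖ ≤ 1 / (|C| + 1) * q x := fun x => by
      have : u' x = u (x - ∑ n ∈ Finset.range N, φ n x • y n) := by
        simp [hu', mul_comm]
      rw [this]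
      exact (hu _).trans (hy x)
    have hpos : (0 : ℝ) < |C| + 1 := by positivity
    have h3 := hC (((|C| + 1 : ℝ) : ℂ) • u') fun x => by
      have := h2 x
      rw [smul_apply, norm_smul, Complex.norm_real, Real.norm_of_nonneg hpos.le]
      calc (|C| + 1) * ‖u' x‖ ≤ (|C| + 1) * (1 / (|C| + 1) * q x) := by gcongr
        _ = q x := by field_simp
    rw [map_smul, norm_smul, Complex.norm_real, Real.norm_of_nonneg hpos.le] at h3
    rw [← h1]
    have h4 := le_abs_self C
    have h5 : 0 ≤ |C| := abs_nonneg C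
    by_contra! hlt
    nlinarith [norm_nonneg (Φ u')]
  have hmono : ∀ q₁ q₂ : Q, (∀ x, q₁.1 x ≤ q₂.1 x) → A q₂ ⊆ A q₁ :=
    fun q₁ q₂ h k hk u hu => hk u fun x => (hu x).trans (h x)
  have hdir : Directed (· ≥ ·) fun q => 𝓟 (A q) := by
    intro q₁ q₂
    refine ⟨⟨q₁.1 + q₂.1, q₁.2.add q₂.2⟩, ?_, ?_⟩ <;>
      refine principal_mono.2 (hmono _ _ fun x => ?_) <;>
      simp
  have : Nonempty Q := ⟨⟨0, continuous_const⟩⟩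
  set F : Filter E := ⨅ q, 𝓟 (A q) with hF
  have hFne : F.NeBot := iInf_neBot_of_directed' hdir fun q => principal_neBot_iff.2 (hne q)
  have hmem : ∀ q, A q ∈ F := fun q => mem_iInf_of_mem q (mem_principal_self _)
  have hcauchy : Cauchy F := by
    refine ⟨hFne, ?_⟩
    rw [uniformity_eq_comap_nhds_zero, ← tendsto_iff_comap]
    intro U hU
    obtain ⟨p, hp, hpU⟩ := exists_seminorm_of_mem_nhds_zero hU
    -- Two points of A (2p) differ by at most 2 under every functional dominated by 2p, so their
    -- p-distance is at most 1.
    have hp2 : Continuous ((2 : NNReal) • p) := hp.const_smul (2 : NNReal)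
    refine mem_map.2 (mem_of_superset (prod_mem_prod (hmem ⟨_, hp2⟩) (hmem ⟨_, hp2⟩)) ?_)
    rintro ⟨a, b⟩ ⟨ha, hb⟩
    refine hpU _ ?_
    have h2 : ((2 : NNReal) • p) (b - a) ≤ 2 := by
      refine seminorm_le_of_forall_functional hp2 fun u hu => ?_
      have : u (b - a) = (Φ u - u a) - (Φ u - u b) := by simp
      rw [this]
      exact (norm_sub_le_of_le (ha u hu) (hb u hu)).trans (by norm_num)
    have h3 : (2 : ℝ) * p (b - a) ≤ 2 := h2
    linarith
  obtain ⟨k, hk⟩ := CompleteSpace.complete hcauchy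
  refine ⟨k, fun u => ?_⟩
  have hlim : Tendsto u F (𝓝 (u k)) := (u.continuous.tendsto k).mono_left hk
  have hlim' : Tendsto u F (𝓝 (Φ u)) := by
    rw [Metric.tendsto_nhds]
    intro ε hε
    -- Error 1 for the multiple (2/ε)u is error ε/2 for u itself.
    let c : NNReal := ⟨2 / ε, by positivity⟩
    have hc : Continuous (c • ((normSeminorm ℂ ℂ).comp (u : E →ₗ[ℂ] ℂ))) :=
      (continuous_norm.comp u.continuous).const_smul c
    filter_upwards [hmem ⟨_, hc⟩] with x hx
    have h1 := hx (((2 / ε : ℝ) : ℂ) • u) fun y => by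
      rw [smul_apply, norm_smul, Complex.norm_real,
        Real.norm_of_nonneg (by positivity)]
      exact le_rfl
    rw [map_smul, smul_apply, ← smul_sub, norm_smul, Complex.norm_real,
      Real.norm_of_nonneg (by positivity), div_mul_eq_mul_div, div_le_one hε] at h1
    rw [dist_comm, dist_eq_norm]
    have := norm_nonneg (Φ u - u x)
    linarith
  exact tendsto_nhds_unique hlim' hlim

end Reflexivity

/-! ### Completed projective tensor product: bilinear maps and equicontinuity -/

theorem setOf_norm_apply_le_one_mem_nhds_zero {E G : Type*} [AddCommGroup E] [Module ℂ E]
    [TopologicalSpace E] [SeminormedAddCommGroup G] [NormedSpace ℂ G] (L : E →L[ℂ] G) :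
    {x | ‖L x‖ ≤ 1} ∈ 𝓝 0 := by
  have h0 : Tendsto (fun x => ‖L x‖) (𝓝 0) (𝓝 0) := by
    simpa using L.continuous.norm.tendsto 0
  exact h0.eventually (ge_mem_nhds one_pos)

section CompletedTensor

variable {E F G : Type*} [AddCommGroup E] [Module ℂ E] [TopologicalSpace E]
  [AddCommGroup F] [Module ℂ F] [TopologicalSpace F]

/-- The element `f ⊗ g` of the completed projective tensor product. -/
noncomputable def completedTmul (f : E) (g : F) : CompletedTensor E F :=
  ((show ProjTensor E F from f ⊗ₜ[ℂ] g) : Completion (ProjTensor E F))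

/-- The defining seminorms only make r(f ⊗ g) a continuous function. Continuity of f ⊗ g itself
follows from f ⊗ g − f₀ ⊗ g₀ = (f − f₀) ⊗ g + f₀ ⊗ (g − g₀), as both terms have seminorms that are
continuous and vanish at (f₀, g₀). -/
theorem continuous_projTmul [IsTopologicalAddGroup E] [IsTopologicalAddGroup F] :
    Continuous fun z : E × F => (show ProjTensor E F from z.1 ⊗ₜ[ℂ] z.2) := by
  rw [continuous_iff_continuousAt]
  rintro ⟨f₀, g₀⟩
  rw [ContinuousAt, (withSeminorms_projTensor E F).tendsto_nhds]
  intro r ε hε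
  let b : E × F → ℝ := fun z => r.1 (z.1 ⊗ₜ[ℂ] z.2 : E ⊗[ℂ] F)
  have hb : Continuous b := r.2
  have hb₁ : ∀ g, b (0, g) = 0 := fun g =>
    (congrArg r.1 (TensorProduct.zero_tmul E g)).trans (map_zero r.1)
  have hb₂ : ∀ f, b (f, 0) = 0 := fun f =>
    (congrArg r.1 (TensorProduct.tmul_zero F f)).trans (map_zero r.1)
  let c : E × F → ℝ := fun z => b (z.1 - f₀, z.2) + b (f₀, z.2 - g₀)
  have hc : Continuous c := by fun_prop
  have hc₀ : c (f₀, g₀) = 0 := by simp [c, hb₁, hb₂]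
  have hev : ∀ᶠ z in 𝓝 (f₀, g₀), c z < ε :=
    hc.continuousAt.eventually (gt_mem_nhds (hc₀ ▸ hε))
  filter_upwards [hev] with z hz
  refine lt_of_le_of_lt ?_ hz
  have hsplit : (z.1 ⊗ₜ[ℂ] z.2 : E ⊗[ℂ] F) - f₀ ⊗ₜ[ℂ] g₀
      = (z.1 - f₀) ⊗ₜ[ℂ] z.2 + f₀ ⊗ₜ[ℂ] (z.2 - g₀) := by
    rw [TensorProduct.sub_tmul, TensorProduct.tmul_sub]
    abel
  exact (congrArg r.1 hsplit).trans_le (map_add_le_add r.1 _ _)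

theorem continuous_completedTmul [IsTopologicalAddGroup E] [IsTopologicalAddGroup F] :
    Continuous fun z : E × F => completedTmul z.1 z.2 :=
  (Completion.continuous_coe _).comp continuous_projTmul

/-- The canonical map of `E ⊗ F` into its completion. -/
noncomputable def projTensorCoe : ProjTensor E F →ₗ[ℂ] CompletedTensor E F where
  toFun a := (a : Completion (ProjTensor E F))
  map_add' a b := Completion.coe_add a b
  map_smul' r a := Completion.coe_smul r a

/-- The canonical bilinear map into the completed projective tensor product. -/
noncomputable def completedTmulBilin : E →ₗ[ℂ] F →ₗ[ℂ] CompletedTensor E F :=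
  (TensorProduct.mk ℂ E F).compr₂ (projTensorCoe : ProjTensor E F →ₗ[ℂ] CompletedTensor E F)

theorem completedTensorFunctional_tmul (u : E →L[ℂ] ℂ) (v : F →L[ℂ] ℂ) (f : E) (g : F) :
    completedTensorFunctional u v (completedTmul f g) = u f * v g :=
  (tensorFunctional u v).fromCompletion_apply_coe (show ProjTensor E F from f ⊗ₜ[ℂ] g)

/-- Continuous linear maps on `E ⊗̃ F` are determined by their values on the tensors `f ⊗ g`. -/
theorem completedTensor_hom_ext [AddCommGroup G] [Module ℂ G] [TopologicalSpace G] [T2Space G]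
    {L L' : CompletedTensor E F →L[ℂ] G}
    (h : ∀ f g, L (completedTmul f g) = L' (completedTmul f g)) : L = L' := by
  ext x
  refine Completion.induction_on x (isClosed_eq L.continuous L'.continuous) fun a => ?_
  have : (L : CompletedTensor E F →ₗ[ℂ] G) ∘ₗ projTensorCoe
      = (L' : CompletedTensor E F →ₗ[ℂ] G) ∘ₗ projTensorCoe :=
    TensorProduct.ext' (M := E) (N := F) h
  exact LinearMap.congr_fun this a

section Lift

variable [AddCommGroup G] [Module ℂ G] [UniformSpace G] [IsUniformAddGroup G]
  [ContinuousConstSMul ℂ G] [PolynormableSpace ℂ G] [CompleteSpace G] [T0Space G]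

/-- The continuous linear map on `E ⊗̃ F` induced by a continuous bilinear map. -/
noncomputable def completedLift (b : E →ₗ[ℂ] F →ₗ[ℂ] G)
    (hb : Continuous fun z : E × F => b z.1 z.2) : CompletedTensor E F →L[ℂ] G :=
  haveI := uniformContinuousConstSMul_of_continuousConstSMul ℂ G
  ContinuousLinearMap.fromCompletion
    ({ toLinearMap := (TensorProduct.lift b : E ⊗[ℂ] F →ₗ[ℂ] G)
       cont := (PolynormableSpace.withSeminorms ℂ G).continuous_of_continuous_comp
          (E := ProjTensor E F) (TensorProduct.lift b : E ⊗[ℂ] F →ₗ[ℂ] G) fun p =>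
        (withSeminorms_projTensor E F).continuous_seminorm
          ⟨p.1.comp (TensorProduct.lift b : E ⊗[ℂ] F →ₗ[ℂ] G), p.2.comp hb⟩ } :
      ProjTensor E F →L[ℂ] G)

theorem completedLift_tmul (b : E →ₗ[ℂ] F →ₗ[ℂ] G)
    (hb : Continuous fun z : E × F => b z.1 z.2) (f : E) (g : F) :
    completedLift b hb (completedTmul f g) = b f g := by
  have := uniformContinuousConstSMul_of_continuousConstSMul ℂ G
  exact (ContinuousLinearMap.fromCompletion_apply_coe _ _).trans (TensorProduct.lift.tmul f g)

end Lift

/-- A continuous bilinear map `β` into a Banach space is controlled by a neighbourhood of zero in the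
completed tensor product, uniformly in the contractions applied to `β`. -/
theorem exists_nhds_forall_norm_le {Y Z : Type*} [NormedAddCommGroup Y] [NormedSpace ℂ Y]
    [NormedAddCommGroup Z] [NormedSpace ℂ Z] [CompleteSpace Z] (β : E →ₗ[ℂ] F →ₗ[ℂ] Z)
    (hβ : Continuous fun z : E × F => β z.1 z.2) :
    ∃ N ∈ 𝓝 (0 : CompletedTensor E F), ∀ x ∈ N, ∀ e : Z →ₗ[ℂ] Y, (∀ z, ‖e z‖ ≤ ‖z‖) →
      ∀ S : CompletedTensor E F →L[ℂ] Y, (∀ f g, S (completedTmul f g) = e (β f g)) →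
        ‖S x‖ ≤ 1 := by
  let Λ := completedLift β hβ
  refine ⟨_, setOf_norm_apply_le_one_mem_nhds_zero Λ, fun x hx e he S hS => ?_⟩
  have hslice : S = e.mkContinuous 1 (fun z => (he z).trans_eq (one_mul _).symm) ∘L Λ :=
    completedTensor_hom_ext fun f g => by
      rw [hS, ContinuousLinearMap.comp_apply, completedLift_tmul]
      rfl
  rw [hslice]
  exact (he _).trans hx

/-- Let `a : E → Y` and `b : F → X` be continuous linear maps into normed spaces. The maps
`a ⊗ (U ∘ b) : E ⊗̃ F → Y` are equicontinuous when `U` runs over the unit ball of the dual of `X`. -/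
theorem exists_nhds_forall_norm_slice_le {X Y : Type*} [IsTopologicalAddGroup E]
    [IsTopologicalAddGroup F] [NormedAddCommGroup X] [NormedSpace ℂ X]
    [NormedAddCommGroup Y] [NormedSpace ℂ Y] [CompleteSpace Y] (a : E →L[ℂ] Y) (b : F →L[ℂ] X) :
    ∃ N ∈ 𝓝 (0 : CompletedTensor E F), ∀ x ∈ N, ∀ U : StrongDual ℂ X, ‖U‖ ≤ 1 →
      ∀ S : CompletedTensor E F →L[ℂ] Y, (∀ f g, S (completedTmul f g) = U (b g) • a f) →
        ‖S x‖ ≤ 1 := by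
  -- All U are treated at once by the operator-valued bilinear map (f, g) ↦ (U ↦ U(b g) a(f));
  -- evaluation at a U in the unit ball is a contraction.
  let dd : F →L[ℂ] StrongDual ℂ (StrongDual ℂ X) := (NormedSpace.inclusionInDoubleDual ℂ X) ∘L b
  let β : E →ₗ[ℂ] F →ₗ[ℂ] (StrongDual ℂ X →L[ℂ] Y) :=
    LinearMap.mk₂ ℂ (fun f g => ContinuousLinearMap.smulRightL ℂ (StrongDual ℂ X) Y (dd g) (a f))
      (fun _ _ _ => by simp only [map_add])
      (fun _ _ _ => by simp only [map_smul])
      (fun _ _ _ => by simp only [map_add, add_apply])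
      (fun _ _ _ => by simp only [map_smul, smul_apply])
  have hβ : Continuous fun z : E × F => β z.1 z.2 := by
    simp only [β, LinearMap.mk₂_apply]
    fun_prop
  obtain ⟨N, hN, h⟩ := exists_nhds_forall_norm_le (Y := Y) (Z := StrongDual ℂ X →L[ℂ] Y) β hβ
  refine ⟨N, hN, fun x hx U hU S hS => ?_⟩
  refine h x hx
    { toFun := fun z => z U
      map_add' := fun _ _ => rfl
      map_smul' := fun _ _ => rfl } (fun z => ?_) S hS
  exact (z.le_opNorm U).trans (mul_le_of_le_one_right (norm_nonneg z) hU)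

end CompletedTensor

/-! ### Local Banach spaces and slice maps -/

section LocalBanach

variable {E : Type*} [AddCommGroup E] [Module ℂ E] [TopologicalSpace E] [IsTopologicalAddGroup E]

/-- The identity map of `E` into `E` equipped with a continuous seminorm. -/
noncomputable def toSeminormSpaceCLM (p : Seminorm ℂ E) (hp : Continuous p) :
    E →L[ℂ] SeminormSpace p where
  toFun x := x
  map_add' _ _ := rfl
  map_smul' _ _ := rfl
  cont := (norm_withSeminorms ℂ (SeminormSpace p)).continuous_of_continuous_comp
    ({ toFun := fun x => x
       map_add' := fun _ _ => rfl
       map_smul' := fun _ _ => rfl } : E →ₗ[ℂ] SeminormSpace p) fun _ => hp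

/-- The canonical map of `E` into its local Banach space, as a continuous linear map. -/
noncomputable def toLocalBanachCLM (p : Seminorm ℂ E) (hp : Continuous p) :
    E →L[ℂ] LocalBanach p :=
  (Completion.toComplL : SeminormSpace p →L[ℂ] LocalBanach p) ∘L toSeminormSpaceCLM p hp

theorem norm_toLocalBanachCLM (p : Seminorm ℂ E) (hp : Continuous p) (x : E) :
    ‖toLocalBanachCLM p hp x‖ = p x :=
  Completion.norm_coe (E := SeminormSpace p) x

end LocalBanach

section Slice

variable {E : Type*} [AddCommGroup E] [Module ℂ E] [UniformSpace E] [IsUniformAddGroup E]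
  [ContinuousSMul ℂ E] [PolynormableSpace ℂ E] [CompleteSpace E] [T0Space E]

/-- The map `u ⊗ id : E ⊗̃ E → E`. -/
noncomputable def leftSlice (u : E →L[ℂ] ℂ) : CompletedTensor E E →L[ℂ] E :=
  completedLift (LinearMap.mk₂ ℂ (fun f g => u f • g)
    (fun _ _ _ => by simp [add_smul]) (fun _ _ _ => by simp [mul_smul])
    (fun _ _ _ => smul_add _ _ _) (fun _ _ _ => smul_comm _ _ _))
    (by simp only [LinearMap.mk₂_apply]; fun_prop)

/-- The map `id ⊗ u : E ⊗̃ E → E`. -/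
noncomputable def rightSlice (u : E →L[ℂ] ℂ) : CompletedTensor E E →L[ℂ] E :=
  completedLift (LinearMap.mk₂ ℂ (fun f g => u g • f)
    (fun _ _ _ => smul_add _ _ _) (fun _ _ _ => smul_comm _ _ _)
    (fun _ _ _ => by simp [add_smul]) (fun _ _ _ => by simp [mul_smul]))
    (by simp only [LinearMap.mk₂_apply]; fun_prop)

@[simp]
theorem leftSlice_tmul (u : E →L[ℂ] ℂ) (f g : E) : leftSlice u (completedTmul f g) = u f • g :=
  completedLift_tmul ..

@[simp]
theorem rightSlice_tmul (u : E →L[ℂ] ℂ) (f g : E) : rightSlice u (completedTmul f g) = u g • f :=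
  completedLift_tmul ..

theorem apply_leftSlice (u v : E →L[ℂ] ℂ) (h : CompletedTensor E E) :
    v (leftSlice u h) = completedTensorFunctional u v h := by
  have : v ∘L leftSlice u = completedTensorFunctional u v :=
    completedTensor_hom_ext fun f g => by simp [completedTensorFunctional_tmul]
  exact DFunLike.congr_fun this h

theorem apply_rightSlice (u v : E →L[ℂ] ℂ) (h : CompletedTensor E E) :
    u (rightSlice v h) = completedTensorFunctional u v h := by
  have : u ∘L rightSlice v = completedTensorFunctional u v :=
    completedTensor_hom_ext fun f g => by simp [completedTensorFunctional_tmul, mul_comm]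
  exact DFunLike.congr_fun this h

/-- The maps `id ⊗ u : E ⊗̃ E → E` are equicontinuous when `u` runs over the functionals dominated by
a continuous seminorm. -/
theorem rightSlice_equicontinuous {p q : Seminorm ℂ E} (hp : Continuous p) (hq : Continuous q) :
    {x : CompletedTensor E E | ∀ u : E →L[ℂ] ℂ, (∀ y, ‖u y‖ ≤ q y) → p (rightSlice u x) ≤ 1}
      ∈ 𝓝 0 := by
  obtain ⟨N, hN, h⟩ := exists_nhds_forall_norm_slice_le (toLocalBanachCLM p hp)
    (toLocalBanachCLM q hq)
  filter_upwards [hN] with x hx u hu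
  -- A functional dominated by q extends to the local Banach space at q with norm at most 1.
  let v : SeminormSpace q →L[ℂ] ℂ := LinearMap.mkContinuous
    ({ toFun := fun y => u y
       map_add' := u.map_add
       map_smul' := u.map_smul } : SeminormSpace q →ₗ[ℂ] ℂ) 1 fun y => by
        rw [one_mul]; exact hu y
  have hv : ∀ y : SeminormSpace q, v.fromCompletion (y : LocalBanach q) = v y := fun y =>
    v.fromCompletion_apply_coe y
  have hU : ‖v.fromCompletion‖ ≤ 1 := by
    refine ContinuousLinearMap.opNorm_le_bound _ zero_le_one fun z => ?_
    rw [one_mul]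
    refine Completion.induction_on z
      (isClosed_le v.fromCompletion.continuous.norm continuous_norm) fun y => ?_
    rw [hv, Completion.norm_coe]
    exact hu y
  rw [← norm_toLocalBanachCLM p hp]
  refine h x hx v.fromCompletion hU ((toLocalBanachCLM p hp) ∘L rightSlice u) fun f g => ?_
  have hg : v.fromCompletion (toLocalBanachCLM q hq g) = u g := hv _
  rw [ContinuousLinearMap.comp_apply, rightSlice_tmul, map_smul, hg]

end Slice

/-! ### Bounded convergence and the space of multipliers -/

/-- A jointly continuous bilinear map is continuous as a map into the space of operators with the
topology of bounded convergence. -/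
theorem continuous_of_continuous_uncurried {E F G : Type*} [AddCommGroup E] [Module ℂ E]
    [TopologicalSpace E] [IsTopologicalAddGroup E] [ContinuousConstSMul ℂ E]
    [AddCommGroup F] [Module ℂ F] [TopologicalSpace F] [AddCommGroup G] [Module ℂ G]
    [TopologicalSpace G] [IsTopologicalAddGroup G] [ContinuousConstSMul ℂ G]
    (M : E →ₗ[ℂ] F →L[ℂ] G) (h : Continuous fun z : E × F => M z.1 z.2) : Continuous M := by
  refine continuous_of_continuousAt_zero M ?_
  rw [ContinuousAt, map_zero, ContinuousLinearMap.hasBasis_nhds_zero.tendsto_right_iff]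
  rintro ⟨B, U⟩ ⟨hB, hU⟩
  have hpre : (fun z : E × F => M z.1 z.2) ⁻¹' U ∈ 𝓝 ((0 : E), (0 : F)) :=
    h.continuousAt.preimage_mem_nhds (by simpa only [map_zero] using hU)
  rw [nhds_prod_eq] at hpre
  obtain ⟨W, hW, V, hV, hWV⟩ := mem_prod_iff.1 hpre
  -- The bounded set B lies in c V; for g in c⁻¹ W the two scalars cancel by bilinearity.
  obtain ⟨c, hc, hc0⟩ := ((hB hV).eventually.and (eventually_ne_cobounded (0 : ℂ))).exists
  filter_upwards [(set_smul_mem_nhds_zero_iff (inv_ne_zero hc0)).2 hW] with g hg f hf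
  obtain ⟨g', hg', rfl⟩ := hg
  obtain ⟨f', hf', rfl⟩ := hc hf
  have hMgf : M (c⁻¹ • g') (c • f') = M g' f' := by
    rw [map_smul, map_smul, smul_apply, smul_inv_smul₀ hc0]
  change M (c⁻¹ • g') (c • f') ∈ U
  rw [hMgf]
  exact hWV (Set.mk_mem_prod hg' hf')

section Multiplier

variable {d : ℕ} {E : Type*} [AddCommGroup E] [Module ℂ E]

theorem eq_of_forall_apply_eq [TopologicalSpace E] {j : E →L[ℂ] 𝓢(EuclideanSpace ℝ (Fin d), ℂ)}
    (hj : Function.Injective j) {a b : E} (h : ∀ x, j a x = j b x) : a = b :=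
  hj (SchwartzMap.ext h)

theorem tensorEval_completedTmul [TopologicalSpace E]
    {j : E →L[ℂ] 𝓢(EuclideanSpace ℝ (Fin d), ℂ)} (f g : E) (s t : EuclideanSpace ℝ (Fin d)) :
    tensorEval j (completedTmul f g) (s, t) = j f s * j g t :=
  tensorEval_tmul j f g s t

section Operator

variable [TopologicalSpace E] [IsTopologicalAddGroup E] [ContinuousConstSMul ℂ E]
  {j : E →L[ℂ] 𝓢(EuclideanSpace ℝ (Fin d), ℂ)}

@[ext]
theorem PointwiseMultiplier.ext {m m' : PointwiseMultiplier j} (h : ∀ x, m x = m' x) : m = m' :=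
  Subtype.ext (funext h)

theorem PointwiseMultiplier.smul_apply (c : ℂ) (m : PointwiseMultiplier j)
    (x : EuclideanSpace ℝ (Fin d)) :
    (c • m) x = c * m x := rfl

theorem PointwiseMultiplier.toOperator_spec (m : PointwiseMultiplier j) (f : E)
    (x : EuclideanSpace ℝ (Fin d)) :
    j (m.toOperator j f) x = m x * j f x :=
  m.2.2.choose_spec f x

theorem PointwiseMultiplier.toOperator_eq (hj : Function.Injective j) (m : PointwiseMultiplier j)
    {f y : E} (h : ∀ x, j y x = m x * j f x) : m.toOperator j f = y :=
  eq_of_forall_apply_eq hj fun x => (m.toOperator_spec f x).trans (h x).symm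

/-- A continuous linear functional on the space of multipliers is bounded by the values of a
continuous seminorm on the image of a bounded set. -/
theorem exists_bound_of_multiplier_functional [ContinuousSMul ℂ E] [PolynormableSpace ℂ E]
    (hj : Function.Injective j) (w : PointwiseMultiplier j →L[ℂ] ℂ) :
    ∃ (B : Set E) (p : Seminorm ℂ E), IsVonNBounded ℂ B ∧ Continuous p ∧
      ∀ (m : PointwiseMultiplier j) (c : ℝ), 0 < c →
        (∀ f ∈ B, p (m.toOperator j f) ≤ c) → ‖w m‖ ≤ c := by
  have hw := setOf_norm_apply_le_one_mem_nhds_zero w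
  -- `toOperator` is defined by choice, so its value at 0 is identified through the injectivity of
  -- `j`.
  have hzero : PointwiseMultiplier.toOperator j 0 = 0 :=
    ContinuousLinearMap.ext fun f => PointwiseMultiplier.toOperator_eq hj 0 fun x => by
      change j 0 x = 0 * j f x
      simp
  rw [nhds_induced, hzero, mem_comap] at hw
  obtain ⟨S, hS, hSw⟩ := hw
  obtain ⟨⟨B, U⟩, ⟨hB, hU⟩, hBU⟩ := ContinuousLinearMap.hasBasis_nhds_zero.mem_iff.1 hS
  obtain ⟨p, hp, hpU⟩ := exists_seminorm_of_mem_nhds_zero hU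
  refine ⟨B, p, hB, hp, fun m c hc hm => ?_⟩
  have hmem : ‖w (((c⁻¹ : ℝ) : ℂ) • m)‖ ≤ 1 := by
    refine hSw (hBU fun f hf => hpU _ ?_)
    rw [PointwiseMultiplier.toOperator_eq hj (y := ((c⁻¹ : ℝ) : ℂ) • m.toOperator j f),
      map_smul_eq_mul, Complex.norm_real, Real.norm_of_nonneg (by positivity), inv_mul_le_one₀ hc]
    · exact hm f hf
    · intro x
      simp [PointwiseMultiplier.toOperator_spec, PointwiseMultiplier.smul_apply, mul_assoc]
  rwa [map_smul, norm_smul, Complex.norm_real, Real.norm_of_nonneg (by positivity),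
    inv_mul_le_one₀ hc] at hmem

end Operator

/-! ### Consequences of the change of variables -/

section TensorEval

variable [UniformSpace E] [IsUniformAddGroup E] [ContinuousSMul ℂ E] [PolynormableSpace ℂ E]
  [CompleteSpace E] [T0Space E] {j : E →L[ℂ] 𝓢(EuclideanSpace ℝ (Fin d), ℂ)}

theorem apply_leftSlice_delta (h : CompletedTensor E E) (s t : EuclideanSpace ℝ (Fin d)) :
    j (leftSlice (deltaFunctional j s) h) t = tensorEval j h (s, t) :=
  apply_leftSlice (deltaFunctional j s) (deltaFunctional j t) h

theorem apply_rightSlice_delta (h : CompletedTensor E E) (s t : EuclideanSpace ℝ (Fin d)) :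
    j (rightSlice (deltaFunctional j t) h) s = tensorEval j h (s, t) :=
  apply_rightSlice (deltaFunctional j s) (deltaFunctional j t) h

variable {A : CompletedTensor E E →L[ℂ] CompletedTensor E E}

/-- If `h(s, t) ↦ h(s, s - t)` acts on `E ⊗̃ E`, then pointwise multiplication is a jointly
continuous operation on `E`. -/
theorem exists_multiplication_operator (hj : Function.Injective j)
    (hA : ∀ h s t, tensorEval j (A h) (s, t) = tensorEval j h (s, s - t)) :
    ∃ M : E →ₗ[ℂ] E →L[ℂ] E, Continuous M ∧ ∀ g f x, j (M g f) x = j g x * j f x := by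
  obtain ⟨μ, hcont, hμ⟩ : ∃ μ : E → E → E, (Continuous fun z : E × E => μ z.1 z.2) ∧
      ∀ g f x, j (μ g f) x = j g x * j f x :=
    -- At t = 0 the substitution evaluates g ⊗ f on the diagonal (s, s).
    ⟨fun g f => rightSlice (deltaFunctional j 0) (A (completedTmul g f)),
      (rightSlice _).continuous.comp (A.continuous.comp continuous_completedTmul),
      fun g f x => by
        rw [apply_rightSlice_delta, hA, sub_zero, tensorEval_completedTmul]⟩
  let M : E →ₗ[ℂ] E →L[ℂ] E :=
    { toFun := fun g =>
        { toFun := μ g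
          map_add' := fun a b => eq_of_forall_apply_eq hj fun x => by simp [hμ, mul_add]
          map_smul' := fun c a => eq_of_forall_apply_eq hj fun x => by simp [hμ, mul_left_comm]
          cont := hcont.comp (Continuous.prodMk_right g) }
      map_add' := fun a b => ContinuousLinearMap.ext fun f =>
        eq_of_forall_apply_eq hj fun x => by
          change j (μ (a + b) f) x = j (μ a f + μ b f) x
          simp [hμ, add_mul]
      map_smul' := fun c a => ContinuousLinearMap.ext fun f =>
        eq_of_forall_apply_eq hj fun x => by
          change j (μ (c • a) f) x = j (c • μ a f) x
          simp [hμ, mul_assoc] }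
  exact ⟨M, continuous_of_continuous_uncurried M hcont, hμ⟩

/-- If `h(s, t) ↦ h(s, s - t)` acts on `E ⊗̃ E`, then `E` is continuously contained in its space of
multipliers. -/
theorem exists_injection_multiplier (hj : Function.Injective j)
    (hA : ∀ h s t, tensorEval j (A h) (s, t) = tensorEval j h (s, s - t)) :
    ∃ i : E →L[ℂ] PointwiseMultiplier j, ∀ g x, i g x = j g x := by
  obtain ⟨M, hM, hμ⟩ := exists_multiplication_operator hj hA
  let i : E →ₗ[ℂ] PointwiseMultiplier j :=
    { toFun := fun g => ⟨fun x => j g x, (j g).continuous, M g, hμ g⟩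
      map_add' := fun a b => PointwiseMultiplier.ext fun x =>
        congrArg (fun φ : 𝓢(EuclideanSpace ℝ (Fin d), ℂ) => φ x) (map_add j a b)
      map_smul' := fun c a => PointwiseMultiplier.ext fun x =>
        congrArg (fun φ : 𝓢(EuclideanSpace ℝ (Fin d), ℂ) => φ x) (map_smul j c a) }
  have hi : PointwiseMultiplier.toOperator j ∘ i = M :=
    funext fun g => ContinuousLinearMap.ext fun f =>
      PointwiseMultiplier.toOperator_eq hj (i g) (hμ g f)
  exact ⟨⟨i, continuous_induced_rng.2 (hi ▸ hM)⟩, fun g x => rfl⟩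

/-- If `h(s, t) ↦ h(s, s - t)` acts on `E ⊗̃ E`, then the functions of a nonzero space `E` have no
common zeros. -/
theorem forall_exists_apply_ne_zero
    (hA : ∀ h s t, tensorEval j (A h) (s, t) = tensorEval j h (s, s - t))
    (hne : ∃ (f : E) (s : EuclideanSpace ℝ (Fin d)), j f s ≠ 0) (s : EuclideanSpace ℝ (Fin d)) :
    ∃ f : E, j f s ≠ 0 := by
  let U : Set (EuclideanSpace ℝ (Fin d)) := {s | ∃ f : E, j f s ≠ 0}
  have hUo : IsOpen U := by
    have : U = ⋃ f : E, {s | j f s ≠ 0} := by ext; simp [U]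
    rw [this]
    exact isOpen_iUnion fun f => isOpen_ne_fun (j f).continuous continuous_const
  -- The slice t ↦ f(a) g(a − t) belongs to E and has the value f(a) g(b) at t = a − b.
  have hsub : ∀ a ∈ U, ∀ b ∈ U, a - b ∈ U := by
    rintro a ⟨f, hf⟩ b ⟨g, hg⟩
    refine ⟨leftSlice (deltaFunctional j a) (A (completedTmul f g)), ?_⟩
    rw [apply_leftSlice_delta, hA, sub_sub_cancel, tensorEval_completedTmul]
    exact mul_ne_zero hf hg
  obtain ⟨f₀, s₀, h₀⟩ := hne
  have hs₀ : s₀ ∈ U := ⟨f₀, h₀⟩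
  have hzero : (0 : EuclideanSpace ℝ (Fin d)) ∈ U := by simpa using hsub s₀ hs₀ s₀ hs₀
  have hneg : ∀ a ∈ U, -a ∈ U := fun a ha => by simpa using hsub 0 hzero a ha
  let S : AddSubgroup (EuclideanSpace ℝ (Fin d)) :=
    { carrier := U
      zero_mem' := hzero
      add_mem' := fun {a b} ha hb => by simpa using hsub a ha (-b) (hneg b hb)
      neg_mem' := fun {a} ha => hneg a ha }
  -- U is an open subgroup, hence closed, and ℝᵈ is connected.
  have hS : IsClopen (S : Set (EuclideanSpace ℝ (Fin d))) := ⟨S.isClosed_of_isOpen hUo, hUo⟩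
  have huniv := hS.eq_univ ⟨0, hzero⟩
  have : s ∈ (S : Set (EuclideanSpace ℝ (Fin d))) := huniv ▸ Set.mem_univ s
  exact this

variable {Q : CompletedTensor E E →L[ℂ] CompletedTensor E E}
  {χ : EuclideanSpace ℝ (Fin d) × EuclideanSpace ℝ (Fin d) → ℂ}

/-- The slice at s of the transformed f ⊗ g is f(s) χ(s,t) g(s−t); a function f not vanishing at s
can be divided out. -/
theorem exists_shift
    (hA : ∀ h s t, tensorEval j (A h) (s, t) = tensorEval j h (s, s - t))
    (hE : ∀ s, ∃ f : E, j f s ≠ 0)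
    (hQ : ∀ h z, tensorEval j (Q h) z = χ z * tensorEval j h z) (g : E)
    (s : EuclideanSpace ℝ (Fin d)) :
    ∃ k : E, ∀ t, j k t = χ (s, t) * j g (s - t) := by
  obtain ⟨f, hf⟩ := hE s
  refine ⟨(j f s)⁻¹ • leftSlice (deltaFunctional j s) (Q (A (completedTmul f g))), fun t => ?_⟩
  rw [map_smul, smul_apply, apply_leftSlice_delta, hQ, hA, tensorEval_completedTmul,
    smul_eq_mul]
  field_simp

theorem exists_reflection
    (hA : ∀ h s t, tensorEval j (A h) (s, t) = tensorEval j h (s, s - t))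
    (hE : ∀ s, ∃ f : E, j f s ≠ 0) :
    ∃ ρ : E → E, Continuous ρ ∧ ∀ g t, j (ρ g) t = j g (-t) := by
  obtain ⟨f, hf⟩ := hE 0
  refine ⟨fun g => (j f 0)⁻¹ • leftSlice (deltaFunctional j 0) (A (completedTmul f g)), ?_,
    fun g t => ?_⟩
  · exact ((leftSlice _).continuous.comp (A.continuous.comp
      (continuous_completedTmul.comp (Continuous.prodMk_right f)))).const_smul _
  · rw [map_smul, smul_apply, apply_leftSlice_delta, hA, tensorEval_completedTmul,
      smul_eq_mul, inv_mul_cancel_left₀ hf, zero_sub]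

/-- A functional `w` on the space of multipliers of a nuclear space `E` transforms the family of
multipliers `t ↦ χ(t, s) g(s - t)` into an element of `E` that depends continuously on `g`. -/
theorem exists_twisted_operator (hnuc : IsNuclearSpace E) (hj : Function.Injective j)
    (hA : ∀ h s t, tensorEval j (A h) (s, t) = tensorEval j h (s, s - t))
    (hE : ∀ s, ∃ f : E, j f s ≠ 0)
    (hQ : ∀ h z, tensorEval j (Q h) z = χ z * tensorEval j h z)
    (w : PointwiseMultiplier j →L[ℂ] ℂ) :
    ∃ T : E →L[ℂ] E, ∀ g s, ∀ m : PointwiseMultiplier j,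
      (∀ t, m t = χ (t, s) * j g (s - t)) → j (T g) s = w m := by
  obtain ⟨ρ, hρc, hρ⟩ := exists_reflection hA hE
  have hK : ∀ g s, ∃ k : E, ∀ t, j k t = χ (s, t) * j g (t - s) := fun g s => by
    obtain ⟨k, hk⟩ := exists_shift hA hE hQ (ρ g) s
    exact ⟨k, fun t => by rw [hk, hρ, neg_sub]⟩
  choose K hK using hK
  -- As a function, H(f, g) is χ(s,t) f(s) g(t−s): its left slice at s is f(s) K_s, and its right
  -- slice by u is the product of f with s ↦ u(K_s).
  let H : E × E → CompletedTensor E E := fun z => Q (A (completedTmul z.1 (ρ z.2)))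
  have hHc : Continuous H := Q.continuous.comp (A.continuous.comp
    (continuous_completedTmul.comp (continuous_fst.prodMk (hρc.comp continuous_snd))))
  have hHleft : ∀ f g s, leftSlice (deltaFunctional j s) (H (f, g)) = j f s • K g s :=
    fun f g s => eq_of_forall_apply_eq hj fun t => by
      rw [apply_leftSlice_delta, hQ, hA, tensorEval_completedTmul, hρ, neg_sub, map_smul,
        smul_apply, hK, smul_eq_mul]
      ring
  let R : (E →L[ℂ] ℂ) → E → E → E := fun u g f => rightSlice u (H (f, g))
  have hR : ∀ u g f s, j (R u g f) s = u (K g s) * j f s := fun u g f s => by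
    have h1 : j (R u g f) s = u (leftSlice (deltaFunctional j s) (H (f, g))) :=
      (apply_rightSlice (deltaFunctional j s) u _).trans
        (apply_leftSlice (deltaFunctional j s) u _).symm
    rw [h1, hHleft, map_smul, smul_eq_mul, mul_comm]
  have hcont : ∀ g (u : E →L[ℂ] ℂ), Continuous fun s => u (K g s) := fun g u => by
    rw [continuous_iff_continuousAt]
    intro s₀
    obtain ⟨f, hf⟩ := hE s₀
    have hev : ∀ᶠ s in 𝓝 s₀, j f s ≠ 0 :=
      (j f).continuous.continuousAt.eventually (isOpen_ne.mem_nhds hf)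
    -- Near a point where f does not vanish, u(K_s) is a quotient of two continuous functions.
    have hq : ContinuousAt (fun s => j (R u g f) s / j f s) s₀ :=
      (j _).continuous.continuousAt.div (j f).continuous.continuousAt hf
    refine hq.congr ?_
    filter_upwards [hev] with s hs
    rw [hR, mul_div_cancel_right₀ _ hs]
  let mult : E → (E →L[ℂ] ℂ) → PointwiseMultiplier j := fun g u =>
    ⟨fun s => u (K g s), hcont g u,
      { toFun := R u g
        map_add' := fun a b => eq_of_forall_apply_eq hj fun x => by simp [hR, mul_add]
        map_smul' := fun c a => eq_of_forall_apply_eq hj fun x => by simp [hR, mul_left_comm]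
        cont := (rightSlice u).continuous.comp (hHc.comp (Continuous.prodMk_left g)) },
      hR u g⟩
  have hop : ∀ g u f, (mult g u).toOperator j f = R u g f := fun g u f =>
    PointwiseMultiplier.toOperator_eq hj _ (hR u g f)
  have hK_add : ∀ g g' s, K (g + g') s = K g s + K g' s := fun g g' s =>
    eq_of_forall_apply_eq hj fun x => by simp [hK, mul_add]
  have hK_smul : ∀ (c : ℂ) g s, K (c • g) s = c • K g s := fun c g s =>
    eq_of_forall_apply_eq hj fun x => by simp [hK, mul_left_comm]
  have hmult_add : ∀ g g' u, mult (g + g') u = mult g u + mult g' u := fun g g' u =>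
    PointwiseMultiplier.ext fun s => (congrArg u (hK_add g g' s)).trans (map_add u _ _)
  have hmult_smul : ∀ (c : ℂ) g u, mult (c • g) u = c • mult g u := fun c g u =>
    PointwiseMultiplier.ext fun s => (congrArg u (hK_smul c g s)).trans (map_smul u _ _)
  let Φ : E → (E →L[ℂ] ℂ) →ₗ[ℂ] ℂ := fun g =>
    { toFun := fun u => w (mult g u)
      map_add' := fun u u' => (congrArg w (PointwiseMultiplier.ext fun s => rfl)).trans
        (map_add w (mult g u) (mult g u'))
      map_smul' := fun c u => (congrArg w (PointwiseMultiplier.ext fun s => rfl)).trans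
        (map_smul w c (mult g u)) }
  obtain ⟨B, p, hB, hp, hw⟩ := exists_bound_of_multiplier_functional hj w
  -- Uniformity in g serves twice: after scaling a given g into W it yields the boundedness needed
  -- to represent `Φ g`, and it yields the continuity of T.
  have hbound : ∀ q : Seminorm ℂ E, Continuous q → ∃ C : ℝ, ∃ W ∈ 𝓝 (0 : E), ∀ g ∈ W,
      ∀ u : E →L[ℂ] ℂ, (∀ y, ‖u y‖ ≤ q y) → ‖Φ g u‖ ≤ C := fun q hq => by
    have hH0 : H (0, 0) = 0 := by
      have : completedTmul (0 : E) (ρ 0) = 0 :=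
        congrArg (fun L : E →ₗ[ℂ] CompletedTensor E E => L (ρ 0)) (map_zero completedTmulBilin)
      simp only [H, this, map_zero]
    have hpre := hHc.continuousAt.preimage_mem_nhds (x := ((0 : E), (0 : E)))
      (by rw [hH0]; exact rightSlice_equicontinuous hp hq)
    rw [nhds_prod_eq] at hpre
    obtain ⟨V, hV, W, hW, hVW⟩ := mem_prod_iff.1 hpre
    obtain ⟨c, hc, hc0⟩ := ((hB hV).eventually.and (eventually_ne_cobounded (0 : ℂ))).exists
    refine ⟨‖c‖, W, hW, fun g hg u hu => hw _ _ (norm_pos_iff.2 hc0) fun f hf => ?_⟩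
    obtain ⟨f', hf', rfl⟩ := hc hf
    have h1 : p (R u g f') ≤ 1 := hVW (Set.mk_mem_prod hf' hg) u hu
    calc p ((mult g u).toOperator j (c • f')) = ‖c‖ * p (R u g f') := by
          rw [map_smul, map_smul_eq_mul, hop]
      _ ≤ ‖c‖ := mul_le_of_le_one_right (norm_nonneg c) h1
  have hrep : ∀ g, ∃ k : E, ∀ u : E →L[ℂ] ℂ, Φ g u = u k := fun g => by
    refine hnuc.exists_eq_eval (Φ g) fun q hq => ?_
    obtain ⟨C, W, hW, hC⟩ := hbound q hq
    obtain ⟨c, hc, hc0⟩ := ((absorbent_nhds_zero (𝕜 := ℂ) hW g).eventually.and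
      (eventually_ne_cobounded (0 : ℂ))).exists
    obtain ⟨g', hg', hgg'⟩ := hc (Set.mem_singleton g)
    refine ⟨‖c‖ * C, fun u hu => ?_⟩
    have : Φ g u = c * Φ g' u := by
      change w (mult g u) = c * w (mult g' u)
      rw [← hgg', hmult_smul, map_smul, smul_eq_mul]
    rw [this, norm_mul]
    exact mul_le_mul_of_nonneg_left (hC g' hg' u hu) (norm_nonneg c)
  choose T hT using hrep
  have hTs : ∀ g s, j (T g) s = w (mult g (deltaFunctional j s)) := fun g s =>
    (hT g (deltaFunctional j s)).symm
  let T' : E →ₗ[ℂ] E :=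
    { toFun := T
      map_add' := fun a b => eq_of_forall_apply_eq hj fun s => by
        simp [hTs, hmult_add]
      map_smul' := fun c a => eq_of_forall_apply_eq hj fun s => by
        simp [hTs, hmult_smul] }
  have hT'c : Continuous T' := by
    refine (PolynormableSpace.withSeminorms ℂ E).continuous_of_continuous_comp T' fun q => ?_
    obtain ⟨C, W, hW, hC⟩ := hbound q.1 q.2
    refine Seminorm.continuous' (r := C) (mem_of_superset hW fun g hg => ?_)
    rw [Seminorm.mem_closedBall_zero]
    -- Since u(T g) = Φ g u, the bound on Φ over the polar of q is a bound on q(T g).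
    exact seminorm_le_of_forall_functional q.2 fun u hu => (hT g u) ▸ hC g hg u hu
  refine ⟨⟨T', hT'c⟩, fun g s m hm => (hTs g s).trans (congrArg w ?_)⟩
  exact PointwiseMultiplier.ext fun t => (hK g t s).trans (hm t).symm

end TensorEval

end Multiplier

/-! ### The inclusion of M'(E) in the twisted multipliers -/

theorem theorem2 {d : ℕ} {E : Type*} [AddCommGroup E] [Module ℂ E] [UniformSpace E]
    [IsUniformAddGroup E] [ContinuousSMul ℂ E] [PolynormableSpace ℂ E]
    [CompleteSpace E] [BarrelledSpace ℂ E] (hnuc : IsNuclearSpace E)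
    (j : E →L[ℂ] 𝓢(EuclideanSpace ℝ (Fin d), ℂ)) (hj : Function.Injective j)
    (θ : LinearMap.BilinForm ℝ (EuclideanSpace ℝ (Fin d)))
    (hθalt : θ.IsAlt) (hθnd : θ.Nondegenerate)
    (hexp : IsPointwiseMultiplier (tensorEval j)
      fun z => Complex.exp (-(Complex.I / 2) * (θ z.1 z.2 : ℂ)))
    (hinv : ∃ A : CompletedTensor E E ≃L[ℂ] CompletedTensor E E,
      ∀ h s t, tensorEval j (A h) (s, t) = tensorEval j h (s, s - t))
    (hdense : Dense {m : PointwiseMultiplier j | ∃ g : E, ∀ x, m x = j g x}) :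
    ∃ i : E →L[ℂ] PointwiseMultiplier j,
      (∀ g x, i g x = j g x) ∧
      Function.Injective (fun w : PointwiseMultiplier j →L[ℂ] ℂ => w ∘L i) ∧
      ∀ w : PointwiseMultiplier j →L[ℂ] ℂ, w ∘L i ∈ twistedMultipliers j θ := by
  have : T2Space E := T2Space.of_injective_continuous hj j.continuous
  obtain ⟨A', hA'⟩ := hinv
  obtain ⟨A, hA⟩ : ∃ A : CompletedTensor E E →L[ℂ] CompletedTensor E E,
      ∀ h s t, tensorEval j (A h) (s, t) = tensorEval j h (s, s - t) := ⟨A', hA'⟩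
  obtain ⟨-, P, hP⟩ := hexp
  -- Conjugating by the substitution replaces θ(s,t) by θ(s,s−t) = −θ(s,t), which gives the opposite
  -- sign in the exponential.
  let Q : CompletedTensor E E →L[ℂ] CompletedTensor E E := A ∘L P ∘L A
  have hQ : ∀ h z, tensorEval j (Q h) z
      = Complex.exp (Complex.I / 2 * (θ z.1 z.2 : ℂ)) * tensorEval j h z := by
    rintro h ⟨s, t⟩
    change tensorEval j (A (P (A h))) (s, t) = _
    rw [hA, hP, hA, sub_sub_cancel]
    simp [hθalt s]
  obtain ⟨i, hi⟩ := exists_injection_multiplier hj hA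
  refine ⟨i, hi, fun w w' hww' => ?_, fun w => ?_⟩
  · refine DFunLike.coe_injective (w.continuous.ext_on hdense w'.continuous ?_)
    rintro m ⟨g, hg⟩
    obtain rfl : m = i g := PointwiseMultiplier.ext fun x => (hg x).trans (hi g x).symm
    exact DFunLike.congr_fun hww' g
  by_cases hne : ∃ (f : E) (s : EuclideanSpace ℝ (Fin d)), j f s ≠ 0
  · have hE := forall_exists_apply_ne_zero hA hne
    have hswap : ∀ s t, (θ t s : ℂ) = -(θ s t : ℂ) := fun s t => by
      rw [← hθalt.neg_eq s t, Complex.ofReal_neg]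
    constructor
    -- T is built from χ(t,s), with the arguments interchanged; by skew-symmetry the minus sign of
    -- `P` becomes the plus sign of v ⊛ g, while the shift at fixed s uses `Q`.
    · obtain ⟨T, hT⟩ := exists_twisted_operator hnuc hj hA hE hP w
      refine ⟨T, fun g s => ?_⟩
      obtain ⟨k, hk⟩ := exists_shift hA hE hQ g s
      refine ⟨k, hk, hT g s (i k) fun t => ?_⟩
      rw [hi, hk]
      simp [hswap s t]
    · obtain ⟨T, hT⟩ := exists_twisted_operator hnuc hj hA hE hQ w
      refine ⟨T, fun g s => ?_⟩
      obtain ⟨k, hk⟩ := exists_shift hA hE hP g s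
      refine ⟨k, hk, hT g s (i k) fun t => ?_⟩
      rw [hi, hk]
      simp [hswap s t]
  -- Here every function in E vanishes identically, and the zero operator serves on both sides.
  · push Not at hne
    constructor <;>
    exact ⟨0, fun g s => ⟨0, fun t => by simp [hne], by simp⟩⟩
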